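/- All languages are relational: they consist of predicate symbols of positive arity. $\overline{\mathcal T}$ denotes the class of all complete elementary theories $\mathrm{Th}(\mathcal A)$ of nonempty structures $\mathcal A$ of relational languages; different theories may have different, possibly overlapping, languages. Let $(\mathcal A_i)_{i\in I}$ be a family of pairwise disjoint structures of relational languages $\Sigma_i$, and let $(P_i)_{i\in I}$ be distinct unary predicate symbols that do not belong to any $\Sigma_j$. The disjoint $P$-combination $\mathcal A_P$ of this family is the structure of the language $\bigcup_i\Sigma_i\cup\{P_i\mid i\in I\}$ whose universe is the disjoint union of the universes of the $\mathcal A_i$, in which every $R\in\bigcup_i\Sigma_i$ is interpreted by the union of its interpretations in those $\mathcal A_i$ with $R\in\Sigma_i$, and every $P_i$ is interpreted by the universe of $\mathcal A_i$. Put $p_\infty(x)=\{\neg P_i(x)\mid i\in I\}$. For a family $\mathcal T\subseteq\overline{\mathcal T}$ let $\hat c^{d,r}_P(\mathcal T)$ be the set of all finite cardinalities of models of theories $\mathrm{Th}(\mathcal N)$, where $\mathcal N$ is the restriction of some structure $\mathcal A'\equiv\mathcal A_P$ to its set of realizations of $p_\infty(x)$, this set being nonempty, and $\mathcal A_P$ is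 the disjoint $P$-combination of some family $(\mathcal A_i)_{i\in I}$ with $\mathrm{Th}(\mathcal A_i)\in\mathcal T$ for all $i\in I$ (repetitions permitted: the theories $\mathrm{Th}(\mathcal A_i)$ need not be distinct). For $K\subseteq\omega$ let $\biguplus_{k\in K}k\mathbb Z^+$ be the set of all sums of finitely many (at least one) numbers, each of which belongs to $k\mathbb Z^+=\{kj\mid j\ge 1\}$ for some $k\in K$; in particular it is empty for $K=\varnothing$. **Theorem 6.5.** For every nonempty family $\mathcal T\subseteq\overline{\mathcal T}$ there is a set $K\subset\omega$ such that $$\hat c^{d,r}_P(\mathcal T)=\biguplus_{k\in K}k\mathbb Z^+.$$ -/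

import Mathlib

open scoped FirstOrder

universe u

namespace PCombination

/-- A signature: for each `n`, a set of `n`-ary predicate symbols, chosen from a common supply
`Symb` of predicate symbols (`Symb n` being the symbols of arity `n`). Different signatures may
overlap in an arbitrary way. -/
abbrev Signature (Symb : ℕ → Type u) : Type u := ∀ n, Set (Symb n)

/-- The relational first-order language with signature `σ`. -/
def Signature.lang {Symb : ℕ → Type u} (σ : Signature Symb) : FirstOrder.Language.{0, u} :=
  ⟨fun _ => Empty, fun n => σ n⟩

/-- A complete elementary theory of a relational language: a signature together with a maximal
satisfiable set of sentences of the corresponding language, that is, `Th(A)` for a (nonempty)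
structure `A` of that language. Different theories may have different languages. -/
structure CompleteTheory (Symb : ℕ → Type u) : Type u where
  sig : Signature Symb
  theory : sig.lang.Theory
  isMaximal : theory.IsMaximal

section Combination

variable {Symb : ℕ → Type u} {I : Type u}

/-- The predicate symbols of a `P`-combination of structures of signatures `σ i`: the symbols that
belong to some `σ i`, and new unary predicate symbols `P_i`. -/
inductive CombRel (σ : I → Signature Symb) : ℕ → Type u
  | old {n : ℕ} (R : Symb n) (h : ∃ i, R ∈ σ i n) : CombRel σ n
  | pred (i : I) : CombRel σ 1

/-- The language of a `P`-combination of structures of signatures `σ i`. -/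
def combLang (σ : I → Signature Symb) : FirstOrder.Language.{0, u} :=
  ⟨fun _ => Empty, CombRel σ⟩

/-- The disjoint `P`-combination of the structures `A i`: the universe is the disjoint union, a
predicate symbol `R` is interpreted by the union of its interpretations in those `A i` whose
language contains `R`, and `P_i` is interpreted by the universe of `A i`. -/
instance combStructure (σ : I → Signature Symb) (A : I → Type u)
    [∀ i, (σ i).lang.Structure (A i)] : (combLang σ).Structure (Σ i, A i) where
  funMap f := nomatch f
  RelMap
    | CombRel.old (n := n) R _, x => ∃ (i : I) (h : R ∈ σ i n) (y : Fin n → A i),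
        (∀ k, x k = ⟨i, y k⟩) ∧
          FirstOrder.Language.Structure.RelMap (L := (σ i).lang) (M := A i) (⟨R, h⟩ : σ i n) y
    | CombRel.pred i, x => (x 0).1 = i

/-- The set of realizations of the type `p_∞(x) = {¬ P_i(x) | i ∈ I}` in a structure `M`, as a
substructure of `M` (the language being relational, every subset is one). -/
def pInfty (σ : I → Signature Symb) (M : Type u) [(combLang σ).Structure M] :
    (combLang σ).Substructure M where
  carrier := {a | ∀ i, ¬ FirstOrder.Language.Structure.RelMap (L := combLang σ) (CombRel.pred i) ![a]}
  fun_mem := fun f => nomatch f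

end Combination

/-- `ĉ^{d,r}_P(𝒯)`: the set of finite cardinalities of models of the theories `Th(M ↾ p_∞)`, where
`M` is elementarily equivalent to a disjoint `P`-combination of structures `A i`, `i ∈ I`, whose
theories `t i` belong to `𝒯` (repetitions are permitted: `t` need not be injective), and where
`p_∞` is realized in `M`, so that the restriction of `M` is a (nonempty) structure. -/
def cHatDR {Symb : ℕ → Type u} (𝒯 : Set (CompleteTheory Symb)) : Set ℕ :=
  {n | ∃ (I : Type u) (t : I → CompleteTheory Symb) (_ : ∀ i, t i ∈ 𝒯)
      (A : I → Type u) (_ : ∀ i, (t i).sig.lang.Structure (A i)) (_ : ∀ i, A i ⊨ (t i).theory)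
      (M : Type u) (_ : (combLang fun i => (t i).sig).Structure M)
      (_ : (combLang fun i => (t i).sig).ElementarilyEquivalent M (Σ i, A i))
      (_ : Nonempty (pInfty (fun i => (t i).sig) M))
      (B : Type u) (_ : (combLang fun i => (t i).sig).Structure B),
      B ⊨ (combLang fun i => (t i).sig).completeTheory (pInfty (fun i => (t i).sig) M) ∧
        Finite B ∧ Nat.card B = n}

/-- `⨄_{k ∈ K} k ℤ⁺`: the set of all sums of finitely many (at least one) numbers, each of which
belongs to one of the sets `k ℤ⁺ = {k * j | j ≥ 1}`, `k ∈ K`. -/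
def sumsOfMultiples (K : Set ℕ) : Set ℕ :=
  {n | ∃ s : Multiset ℕ, s ≠ 0 ∧ (∀ m ∈ s, ∃ k ∈ K, ∃ j : ℕ, 0 < j ∧ m = k * j) ∧ s.sum = n}

end PCombination

/-! One may take `K` to be `cHatDR 𝒯` itself. A set of naturals closed under addition contains the
positive multiples of its elements and the nonempty finite sums of these, so it equals its own
`sumsOfMultiples`. What remains is `add_mem_cHatDR`.

Let `M` and `N` realize `p_∞` in exactly `m` and `n` points, for families indexed by `I` and `J`.
Index the two families together by `I ⊕ J`, with fresh predicates even for repeated theories, and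
take the disjoint union of `M` and `N`. Its realizations of `p_∞` are those of `M` together with
those of `N`, so there are `m + n` of them. It is elementarily equivalent to the combination of the
joint family because disjoint sums preserve elementary equivalence, by a Feferman-Vaught argument
(`exists_determines`).

The languages may overlap or differ, so each symbol of the joint language is read on a summand
through a formula, its trace: the symbol itself if the summand's language has it, and `⊥` otherwise.
-/

namespace FirstOrder.Language

-- Disjoint sums and Feferman-Vaught

universe v

/-- A structure `X` presented as a disjoint sum of `M` and `M'`: a relation `R` of `X` holds of a
tuple iff the tuple comes from `M` and satisfies `ψ R` there, or comes from `M'` and satisfies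
`ψ' R` there. -/
structure DisjointSum {L L' L'' : Language.{0, v}}
    (ψ : ∀ {k : ℕ}, L''.Relations k → L.Formula (Fin k))
    (ψ' : ∀ {k : ℕ}, L''.Relations k → L'.Formula (Fin k)) where
  M : Type v
  M' : Type v
  X : Type v
  [str : L.Structure M]
  [str' : L'.Structure M']
  [strX : L''.Structure X]
  e : M ⊕ M' ≃ X
  relMap_iff : ∀ {k : ℕ} (R : L''.Relations k) (x : Fin k → M ⊕ M'),
    Structure.RelMap R (e ∘ x) ↔
      (∃ y : Fin k → M, x = Sum.inl ∘ y ∧ (ψ R).Realize y) ∨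
        (∃ y : Fin k → M', x = Sum.inr ∘ y ∧ (ψ' R).Realize y)

attribute [instance] DisjointSum.str DisjointSum.str' DisjointSum.strX

/-- Two tuples satisfy the same formulas from `F`. -/
def AgreeOn {L : Language.{0, v}} {p : ℕ} (F : Set (L.BoundedFormula Empty p))
    {M N : Type v} [L.Structure M] [L.Structure N] (x : Fin p → M) (y : Fin p → N) : Prop :=
  ∀ θ ∈ F, θ.Realize default x ↔ θ.Realize default y

namespace AgreeOn

variable {L : Language.{0, v}} {p : ℕ} {F G : Set (L.BoundedFormula Empty p)}
  {M N : Type v} [L.Structure M] [L.Structure N] {x : Fin p → M} {y : Fin p → N}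

theorem symm (h : AgreeOn F x y) : AgreeOn F y x := fun θ hθ => (h θ hθ).symm

theorem mono (h : AgreeOn G x y) (hFG : F ⊆ G) : AgreeOn F x y := fun θ hθ => h θ (hFG hθ)

end AgreeOn

/-- Agreement on a suitable finite set of formulas allows one to extend tuples by one element
while keeping agreement on a given finite set of formulas. -/
theorem exists_finite_agreeOn_snoc {L : Language.{0, v}} {p : ℕ}
    {F : Set (L.BoundedFormula Empty (p + 1))} (hF : F.Finite) :
    ∃ F₁ : Set (L.BoundedFormula Empty p), F₁.Finite ∧
      ∀ {M N : Type v} [L.Structure M] [L.Structure N] (x : Fin p → M) (y : Fin p → N),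
        AgreeOn F₁ x y → ∀ a : M, ∃ b : N,
          AgreeOn F (Fin.snoc x a : Fin (p + 1) → M) (Fin.snoc y b : Fin (p + 1) → N) := by
  classical
  have := hF.to_subtype
  -- `χ S` says that some one-element extension has complete `F`-type `S`. Finiteness of `F` makes
  -- this a single formula and leaves only finitely many `S`.
  let χ : Set F → L.BoundedFormula Empty p := fun S =>
    (BoundedFormula.iInf fun θ : F => if θ ∈ S then θ.1 else ∼θ.1).ex
  refine ⟨Set.range χ, Set.finite_range χ, fun {M N} _ _ x y h a => ?_⟩
  let S : Set F := {θ | θ.1.Realize default (Fin.snoc x a : Fin (p + 1) → M)}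
  have hx : (χ S).Realize default x := by
    simp only [χ, BoundedFormula.realize_ex, BoundedFormula.realize_iInf]
    refine ⟨a, fun θ => ?_⟩
    split_ifs with hθ
    · exact hθ
    · exact hθ
  have hy := (h _ ⟨S, rfl⟩).1 hx
  simp only [χ, BoundedFormula.realize_ex, BoundedFormula.realize_iInf] at hy
  obtain ⟨b, hb⟩ := hy
  refine ⟨b, fun θ hθ => ?_⟩
  have := hb ⟨θ, hθ⟩
  split_ifs at this with hS
  · exact ⟨fun _ => this, fun _ => hS⟩
  · exact ⟨fun h => (hS h).elim, fun h => (this h).elim⟩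

namespace DisjointSum

variable {L L' L'' : Language.{0, v}}
  {ψ : ∀ {k : ℕ}, L''.Relations k → L.Formula (Fin k)}
  {ψ' : ∀ {k : ℕ}, L''.Relations k → L'.Formula (Fin k)}

/-- The tuple of elements of the sum described by tuples of elements of the summands. -/
def tuple (D : DisjointSum ψ ψ') {n p q : ℕ} (s : Fin n → Fin p ⊕ Fin q) (x : Fin p → D.M)
    (x' : Fin q → D.M') : Fin n → D.X :=
  fun i => D.e (Sum.map x x' (s i))

theorem snoc_tuple_inl (D : DisjointSum ψ ψ') {n p q : ℕ} (s : Fin n → Fin p ⊕ Fin q)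
    (x : Fin p → D.M) (x' : Fin q → D.M') (a : D.M) :
    (Fin.snoc (D.tuple s x x') (D.e (Sum.inl a)) : Fin (n + 1) → D.X) =
      D.tuple (Fin.snoc (fun i => Sum.map Fin.castSucc id (s i)) (Sum.inl (Fin.last p)) :
        Fin (n + 1) → Fin (p + 1) ⊕ Fin q) (Fin.snoc x a : Fin (p + 1) → D.M) x' := by
  funext i
  refine Fin.lastCases ?_ (fun i => ?_) i
  · simp [tuple]
  · rcases h : s i <;> simp [tuple, h]

theorem snoc_tuple_inr (D : DisjointSum ψ ψ') {n p q : ℕ} (s : Fin n → Fin p ⊕ Fin q)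
    (x : Fin p → D.M) (x' : Fin q → D.M') (a : D.M') :
    (Fin.snoc (D.tuple s x x') (D.e (Sum.inr a)) : Fin (n + 1) → D.X) =
      D.tuple (Fin.snoc (fun i => Sum.map id Fin.castSucc (s i)) (Sum.inr (Fin.last q)) :
        Fin (n + 1) → Fin p ⊕ Fin (q + 1)) x (Fin.snoc x' a : Fin (q + 1) → D.M') := by
  funext i
  refine Fin.lastCases ?_ (fun i => ?_) i
  · simp [tuple]
  · rcases h : s i <;> simp [tuple, h]

variable (ψ ψ') in
/-- The truth of `φ` in a disjoint sum is determined by the truth of the formulas in `F` and `G`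
in the summands. -/
def Determines {n p q : ℕ} (φ : L''.BoundedFormula Empty n) (s : Fin n → Fin p ⊕ Fin q)
    (F : Set (L.BoundedFormula Empty p)) (G : Set (L'.BoundedFormula Empty q)) : Prop :=
  ∀ (D E : DisjointSum ψ ψ') (x : Fin p → D.M) (x' : Fin q → D.M') (y : Fin p → E.M)
    (y' : Fin q → E.M'), AgreeOn F x y → AgreeOn G x' y' →
      φ.Realize default (D.tuple s x x') → φ.Realize default (E.tuple s y y')

/-- If `s` places both variables in the same summand, one equality there decides; in different
summands the equality is always false and no formulas are needed. -/
theorem exists_determines_equal {n p q : ℕ} (i j : Fin n) (s : Fin n → Fin p ⊕ Fin q) :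
    ∃ F G, F.Finite ∧ G.Finite ∧
      Determines ψ ψ' (BoundedFormula.equal (Term.var (Sum.inr i)) (Term.var (Sum.inr j))) s F G := by
  rcases hi : s i with a | a <;> rcases hj : s j with b | b
  · refine ⟨{(Term.var (Sum.inr a)).bdEqual (Term.var (Sum.inr b))}, ∅, Set.finite_singleton _,
      Set.finite_empty, fun D E x x' y y' h _ => ?_⟩
    have := h _ rfl
    simp only [BoundedFormula.realize_bdEqual, Term.realize_var, Sum.elim_inr] at this
    simp [BoundedFormula.Realize, tuple, hi, hj, this]
  · refine ⟨∅, ∅, Set.finite_empty, Set.finite_empty, fun D E x x' y y' _ _ => ?_⟩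
    simp [BoundedFormula.Realize, tuple, hi, hj]
  · refine ⟨∅, ∅, Set.finite_empty, Set.finite_empty, fun D E x x' y y' _ _ => ?_⟩
    simp [BoundedFormula.Realize, tuple, hi, hj]
  · refine ⟨∅, {(Term.var (Sum.inr a)).bdEqual (Term.var (Sum.inr b))}, Set.finite_empty,
      Set.finite_singleton _, fun D E x x' y y' _ h => ?_⟩
    have := h _ rfl
    simp only [BoundedFormula.realize_bdEqual, Term.realize_var, Sum.elim_inr] at this
    simp [BoundedFormula.Realize, tuple, hi, hj, this]

/-- Agreement on a suitable finite set of formulas suffices to transfer a formula `θ` whose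
variables are renamed by `r`, provided that `r` factors through `ι`. -/
theorem exists_finite_agreeOn_rename {K : Language.{0, v}} {k p : ℕ} {C : Type}
    (ι : Fin p → C) (hι : Function.Injective ι) (θ : K.Formula (Fin k)) (r : Fin k → C) :
    ∃ F : Set (K.BoundedFormula Empty p), F.Finite ∧
      ∀ {M N : Type v} [K.Structure M] [K.Structure N] (x : Fin p → M) (y : Fin p → N),
        AgreeOn F x y → (∃ c : Fin k → Fin p, r = ι ∘ c ∧ θ.Realize (x ∘ c)) →
          ∃ c : Fin k → Fin p, r = ι ∘ c ∧ θ.Realize (y ∘ c) := by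
  by_cases h : ∃ c : Fin k → Fin p, r = ι ∘ c
  · obtain ⟨c, rfl⟩ := h
    refine ⟨{BoundedFormula.relabel (n := p) (fun i => (Sum.inr (c i) : Empty ⊕ Fin p)) θ},
      Set.finite_singleton _, fun {M N} _ _ x y hxy ⟨d, hd, hx⟩ => ⟨c, rfl, ?_⟩⟩
    obtain rfl : c = d := hι.comp_left hd
    have key : ∀ {M : Type v} [K.Structure M] (x : Fin p → M),
        (BoundedFormula.relabel (n := p)
          (fun i => (Sum.inr (c i) : Empty ⊕ Fin p)) θ).Realize default x ↔
          θ.Realize (x ∘ c) := by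
      intro M _ x
      refine BoundedFormula.realize_relabel.trans ?_
      rw [Formula.Realize]
      exact iff_of_eq (congrArg₂ _ rfl (Subsingleton.elim _ _))
    exact (key y).1 ((hxy _ rfl).1 ((key x).2 hx))
  -- If `r` leaves the range of `ι`, the premise to be transferred is already false.
  · exact ⟨∅, Set.finite_empty, fun x y _ ⟨c, hc, _⟩ => (h ⟨c, hc⟩).elim⟩

theorem relMap_tuple_iff (D : DisjointSum ψ ψ') {k p q : ℕ} (R : L''.Relations k)
    (r : Fin k → Fin p ⊕ Fin q) (x : Fin p → D.M) (x' : Fin q → D.M') :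
    Structure.RelMap R (D.tuple r x x') ↔
      (∃ c : Fin k → Fin p, r = Sum.inl ∘ c ∧ (ψ R).Realize (x ∘ c)) ∨
        (∃ c : Fin k → Fin q, r = Sum.inr ∘ c ∧ (ψ' R).Realize (x' ∘ c)) := by
  have aux : D.tuple r x x' = D.e ∘ (fun i => Sum.map x x' (r i)) := rfl
  rw [aux, D.relMap_iff]
  refine or_congr ⟨?_, ?_⟩ ⟨?_, ?_⟩
  · rintro ⟨y, hy, h⟩
    have : ∀ i, ∃ c, r i = Sum.inl c := fun i => by
      have := congrFun hy i
      rcases hr : r i with c | c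
      · exact ⟨c, rfl⟩
      · simp [hr] at this
    choose c hc using this
    obtain rfl : y = x ∘ c := funext fun i => by simpa [hc] using (congrFun hy i).symm
    exact ⟨c, funext hc, h⟩
  · rintro ⟨c, rfl, h⟩
    exact ⟨x ∘ c, rfl, h⟩
  · rintro ⟨y, hy, h⟩
    have : ∀ i, ∃ c, r i = Sum.inr c := fun i => by
      have := congrFun hy i
      rcases hr : r i with c | c
      · simp [hr] at this
      · exact ⟨c, rfl⟩
    choose c hc using this
    obtain rfl : y = x' ∘ c := funext fun i => by simpa [hc] using (congrFun hy i).symm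
    exact ⟨c, funext hc, h⟩
  · rintro ⟨c, rfl, h⟩
    exact ⟨x' ∘ c, rfl, h⟩

theorem exists_determines_rel {n k p q : ℕ} (R : L''.Relations k) (f : Fin k → Fin n)
    (s : Fin n → Fin p ⊕ Fin q) :
    ∃ F G, F.Finite ∧ G.Finite ∧
      Determines ψ ψ' (BoundedFormula.rel R fun i => Term.var (Sum.inr (f i))) s F G := by
  obtain ⟨F, hF, hF'⟩ := exists_finite_agreeOn_rename (C := Fin p ⊕ Fin q) Sum.inl
    Sum.inl_injective (ψ R) (s ∘ f)
  obtain ⟨G, hG, hG'⟩ := exists_finite_agreeOn_rename (C := Fin p ⊕ Fin q) Sum.inr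
    Sum.inr_injective (ψ' R) (s ∘ f)
  refine ⟨F, G, hF, hG, fun D E x x' y y' h h' hD => ?_⟩
  exact (E.relMap_tuple_iff R (s ∘ f) y y').2
    (((D.relMap_tuple_iff R (s ∘ f) x x').1 hD).imp (hF' x y h) (hG' x' y' h'))

/-- Feferman-Vaught theorem for disjoint sums of two structures. -/
theorem exists_determines [L''.IsRelational] {n : ℕ} (φ : L''.BoundedFormula Empty n) :
    ∀ {p q : ℕ} (s : Fin n → Fin p ⊕ Fin q),
      ∃ F G, F.Finite ∧ G.Finite ∧ Determines ψ ψ' φ s F G := by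
  have term_eq : ∀ {n : ℕ} (t : L''.Term (Empty ⊕ Fin n)), ∃ i, t = Term.var (Sum.inr i) := by
    rintro n ((a | i) | ⟨f, -⟩)
    · exact a.elim
    · exact ⟨i, rfl⟩
    · exact isEmptyElim f
  induction φ with
  | falsum =>
    exact fun s => ⟨∅, ∅, Set.finite_empty, Set.finite_empty, fun _ _ _ _ _ _ _ _ h => h⟩
  | equal t₁ t₂ =>
    obtain ⟨i, rfl⟩ := term_eq t₁
    obtain ⟨j, rfl⟩ := term_eq t₂
    exact fun {_ _} s => exists_determines_equal i j s
  | rel R ts =>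
    choose f hf using fun i => term_eq (ts i)
    obtain rfl := funext hf
    exact fun {_ _} s => exists_determines_rel R f s
  | imp φ₁ φ₂ ih₁ ih₂ =>
    intro p q s
    obtain ⟨F₁, G₁, hF₁, hG₁, h₁⟩ := ih₁ s
    obtain ⟨F₂, G₂, hF₂, hG₂, h₂⟩ := ih₂ s
    refine ⟨F₁ ∪ F₂, G₁ ∪ G₂, hF₁.union hF₂, hG₁.union hG₂,
      fun D E x x' y y' hF hG h hy => ?_⟩
    -- `Determines` is one-directional but quantifies over all pairs of sums, so the antecedent is
    -- carried back with `D` and `E` exchanged.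
    exact h₂ D E x x' y y' (hF.mono Set.subset_union_right) (hG.mono Set.subset_union_right)
      (h (h₁ E D y y' x x' (hF.symm.mono Set.subset_union_left)
        (hG.symm.mono Set.subset_union_left) hy))
  | all φ ih =>
    intro p q s
    obtain ⟨F₁, G₁, hF₁, hG₁, h₁⟩ := ih (Fin.snoc (fun i => Sum.map Fin.castSucc id (s i))
      (Sum.inl (Fin.last p)) : Fin (_ + 1) → Fin (p + 1) ⊕ Fin q)
    obtain ⟨F₂, G₂, hF₂, hG₂, h₂⟩ := ih (Fin.snoc (fun i => Sum.map id Fin.castSucc (s i))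
      (Sum.inr (Fin.last q)) : Fin (_ + 1) → Fin p ⊕ Fin (q + 1))
    obtain ⟨F₃, hF₃, h₃⟩ := exists_finite_agreeOn_snoc hF₁
    obtain ⟨G₃, hG₃, h₄⟩ := exists_finite_agreeOn_snoc hG₂
    -- A new element in the left summand uses `F₃` (to find its partner) and `G₁`; one in the right
    -- uses `F₂` and `G₃`.
    refine ⟨F₃ ∪ F₂, G₁ ∪ G₃, hF₃.union hF₂, hG₁.union hG₃,
      fun D E x x' y y' hF hG h => ?_⟩
    rw [BoundedFormula.realize_all] at h ⊢
    intro b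
    obtain ⟨b | b, rfl⟩ := E.e.surjective b
    · obtain ⟨a, ha⟩ := h₃ y x (hF.symm.mono Set.subset_union_left) b
      have := h (D.e (Sum.inl a))
      rw [snoc_tuple_inl] at this ⊢
      exact h₁ D E _ _ _ _ ha.symm (hG.mono Set.subset_union_left) this
    · obtain ⟨a, ha⟩ := h₄ y' x' (hG.symm.mono Set.subset_union_right) b
      have := h (D.e (Sum.inr a))
      rw [snoc_tuple_inr] at this ⊢
      exact h₂ D E _ _ _ _ (hF.mono Set.subset_union_right) ha.symm this

/-- Disjoint sums preserve elementary equivalence. -/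
theorem elementarilyEquivalent [L''.IsRelational] (D E : DisjointSum ψ ψ')
    (h : L.ElementarilyEquivalent D.M E.M) (h' : L'.ElementarilyEquivalent D.M' E.M') :
    L''.ElementarilyEquivalent D.X E.X := by
  have key : ∀ D E : DisjointSum ψ ψ', L.ElementarilyEquivalent D.M E.M →
      L'.ElementarilyEquivalent D.M' E.M' → ∀ φ : L''.Sentence, D.X ⊨ φ → E.X ⊨ φ := by
    intro D E h h' φ hφ
    obtain ⟨F, G, -, -, hφ'⟩ := exists_determines (ψ := ψ) (ψ' := ψ') φ
      (Fin.elim0 : Fin 0 → Fin 0 ⊕ Fin 0)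
    have := hφ' D E default default default default
      (fun θ _ => h.realize_sentence θ)
      (fun θ _ => h'.realize_sentence θ)
    unfold Sentence.Realize Formula.Realize at hφ ⊢
    convert this (by convert hφ)
  exact elementarilyEquivalent_iff.2 fun φ => ⟨key D E h h' φ, key E D h.symm h'.symm φ⟩

end DisjointSum

/-- A structure whose complete theory has a finite model has the cardinality of this model. -/
theorem finite_and_natCard_eq_of_model_completeTheory {L : Language.{0, v}} {M N : Type v}
    [L.Structure M] [L.Structure N] (h : N ⊨ L.completeTheory M) [Finite N] :
    Finite M ∧ Nat.card M = Nat.card N := by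
  have hle : ∀ n : ℕ, (n : Cardinal) ≤ Cardinal.mk M ↔ (n : Cardinal) ≤ Cardinal.mk N := by
    intro n
    rw [← Sentence.realize_cardGe L, ← Sentence.realize_cardGe L]
    exact (realize_iff_of_model_completeTheory M N _).symm
  have hM : Finite M := by
    by_contra hM
    rw [not_finite_iff_infinite] at hM
    -- An infinite `M` would force `N` to have more than `Nat.card N` elements.
    have := (hle (Nat.card N + 1)).1 (Cardinal.natCast_le_aleph0.trans (Cardinal.aleph0_le_mk M))
    rw [← Nat.cast_card, Nat.cast_le] at this
    omega
  simp only [← Nat.cast_card, Nat.cast_le] at hle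
  exact ⟨hM, le_antisymm ((hle _).1 le_rfl) ((hle _).2 le_rfl)⟩

end FirstOrder.Language

/-! ### Closure under addition and sums of multiples -/

namespace PCombination

open FirstOrder FirstOrder.Language

theorem sumsOfMultiples_eq_self {S : Set ℕ} (hS : ∀ m ∈ S, ∀ n ∈ S, m + n ∈ S) :
    sumsOfMultiples S = S := by
  have hmul : ∀ k ∈ S, ∀ j : ℕ, 0 < j → k * j ∈ S := by
    intro k hk j hj
    induction j, hj using Nat.le_induction with
    | base => simpa using hk
    | succ j _ ih => rw [mul_add, mul_one]; exact hS _ ih _ hk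
  ext n
  constructor
  · rintro ⟨s, hs, hm, rfl⟩
    refine Multiset.sum_induction_nonempty (· ∈ S) (fun a b ha hb => hS a ha b hb) hs ?_
    intro m hms
    obtain ⟨k, hk, j, hj, rfl⟩ := hm m hms
    exact hmul k hk j hj
  · intro hn
    exact ⟨{n}, by simp, fun m hm => ⟨n, hn, 1, one_pos, by simpa using hm⟩, by simp⟩

instance {Symb : ℕ → Type u} {I : Type u} (σ : I → Signature Symb) :
    (combLang σ).IsRelational :=
  fun _ => inferInstanceAs (IsEmpty Empty)

/-! ### Joining two `P`-combinations -/

section Sum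

variable {Symb : ℕ → Type u} {I J : Type u} (t : I → CompleteTheory Symb)
  (s : J → CompleteTheory Symb)

/-- The language of the `P`-combination of two families taken together. -/
abbrev sumLang : FirstOrder.Language.{0, u} := combLang fun i => (Sum.elim t s i).sig

open Classical in
/-- The trace of a relation of the combined language on the first summand. -/
noncomputable def leftTrace {k : ℕ} :
    (sumLang t s).Relations k → (combLang fun i => (t i).sig).Formula (Fin k)
  | CombRel.old R _ =>
    if h : ∃ i, R ∈ (t i).sig k then
      Relations.formula (L := combLang fun i => (t i).sig) (CombRel.old R h) Term.var
    else ⊥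
  | CombRel.pred (Sum.inl i) =>
    Relations.formula (L := combLang fun i => (t i).sig) (CombRel.pred i) Term.var
  | CombRel.pred (Sum.inr _) => ⊥

open Classical in
/-- The trace of a relation of the combined language on the second summand. -/
noncomputable def rightTrace {k : ℕ} :
    (sumLang t s).Relations k → (combLang fun j => (s j).sig).Formula (Fin k)
  | CombRel.old R _ =>
    if h : ∃ j, R ∈ (s j).sig k then
      Relations.formula (L := combLang fun j => (s j).sig) (CombRel.old R h) Term.var
    else ⊥
  | CombRel.pred (Sum.inl _) => ⊥
  | CombRel.pred (Sum.inr j) =>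
    Relations.formula (L := combLang fun j => (s j).sig) (CombRel.pred j) Term.var

section

variable {t s} {M : Type u} [(combLang fun i => (t i).sig).Structure M]
  {N : Type u} [(combLang fun j => (s j).sig).Structure N]

theorem realize_leftTrace_old {k : ℕ} (R : Symb k) (h : ∃ i, R ∈ (Sum.elim t s i).sig k)
    (x : Fin k → M) :
    (leftTrace t s (CombRel.old R h)).Realize x ↔
      ∃ h' : ∃ i, R ∈ (t i).sig k,
        Structure.RelMap (L := combLang fun i => (t i).sig) (CombRel.old R h') x := by
  rw [leftTrace]
  split_ifs with h'
  · refine Formula.realize_rel.trans ?_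
    exact ⟨fun hx => ⟨h', hx⟩, fun ⟨_, hx⟩ => hx⟩
  · exact ⟨fun hx => hx.elim, fun ⟨hh, _⟩ => (h' hh).elim⟩

theorem realize_rightTrace_old {k : ℕ} (R : Symb k) (h : ∃ i, R ∈ (Sum.elim t s i).sig k)
    (x : Fin k → N) :
    (rightTrace t s (CombRel.old R h)).Realize x ↔
      ∃ h' : ∃ j, R ∈ (s j).sig k,
        Structure.RelMap (L := combLang fun j => (s j).sig) (CombRel.old R h') x := by
  rw [rightTrace]
  split_ifs with h'
  · refine Formula.realize_rel.trans ?_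
    exact ⟨fun hx => ⟨h', hx⟩, fun ⟨_, hx⟩ => hx⟩
  · exact ⟨fun hx => hx.elim, fun ⟨hh, _⟩ => (h' hh).elim⟩

theorem realize_leftTrace_inl (i : I) (x : Fin 1 → M) :
    (leftTrace t s (CombRel.pred (Sum.inl i))).Realize x ↔
      Structure.RelMap (L := combLang fun i => (t i).sig) (CombRel.pred i) x := by
  rw [leftTrace]; exact Formula.realize_rel

theorem not_realize_leftTrace_inr (j : J) (x : Fin 1 → M) :
    ¬ (leftTrace t s (CombRel.pred (Sum.inr j))).Realize x := by
  rw [leftTrace]; exact fun h => h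

theorem not_realize_rightTrace_inl (i : I) (x : Fin 1 → N) :
    ¬ (rightTrace t s (CombRel.pred (Sum.inl i))).Realize x := by
  rw [rightTrace]; exact fun h => h

theorem realize_rightTrace_inr (j : J) (x : Fin 1 → N) :
    (rightTrace t s (CombRel.pred (Sum.inr j))).Realize x ↔
      Structure.RelMap (L := combLang fun j => (s j).sig) (CombRel.pred j) x := by
  rw [rightTrace]; exact Formula.realize_rel

end

/-- The disjoint sum of two structures, in the language of the combination of two families. -/
noncomputable def sumModel (M : Type u) [(combLang fun i => (t i).sig).Structure M] (N : Type u)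
    [(combLang fun j => (s j).sig).Structure N] :
    DisjointSum (leftTrace t s) (rightTrace t s) where
  M := M
  M' := N
  X := M ⊕ N
  strX :=
    { funMap := fun f => nomatch f
      RelMap := fun R x =>
        (∃ y, x = Sum.inl ∘ y ∧ (leftTrace t s R).Realize y) ∨
          (∃ y, x = Sum.inr ∘ y ∧ (rightTrace t s R).Realize y) }
  e := Equiv.refl _
  relMap_iff := fun _ _ => Iff.rfl

section

variable (M : Type u) [(combLang fun i => (t i).sig).Structure M] (N : Type u)
    [(combLang fun j => (s j).sig).Structure N]

/-- The predicates of the second family have trace `⊥` on `M`, so they impose no further condition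
on `a`. -/
theorem inl_mem_pInfty_iff (a : M) :
    (Sum.inl a : M ⊕ N) ∈ pInfty (fun i => (Sum.elim t s i).sig) (sumModel t s M N).X ↔
      a ∈ pInfty (fun i => (t i).sig) M := by
  have key : ∀ R : (sumLang t s).Relations 1,
      Structure.RelMap R (![(Sum.inl a : M ⊕ N)] : Fin 1 → (sumModel t s M N).X) ↔
        (leftTrace t s R).Realize ![a] := by
    intro R
    constructor
    · rintro (⟨y, hy, h⟩ | ⟨y, hy, h⟩)
      · obtain rfl : y = ![a] := funext fun i => by
          obtain rfl := Subsingleton.elim i 0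
          simpa using (Sum.inl_injective (congrFun hy 0)).symm
        exact h
      · exact (Sum.inl_ne_inr (congrFun hy 0)).elim
    · intro h
      refine Or.inl ⟨![a], funext fun i => ?_, h⟩
      obtain rfl := Subsingleton.elim i 0
      rfl
  constructor
  · intro h i hi
    exact h (Sum.inl i) ((key _).2 ((realize_leftTrace_inl i _).2 hi))
  · rintro h (i | j) hi
    · exact h i ((realize_leftTrace_inl i _).1 ((key _).1 hi))
    · exact not_realize_leftTrace_inr j _ ((key _).1 hi)

theorem inr_mem_pInfty_iff (b : N) :
    (Sum.inr b : M ⊕ N) ∈ pInfty (fun i => (Sum.elim t s i).sig) (sumModel t s M N).X ↔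
      b ∈ pInfty (fun j => (s j).sig) N := by
  have key : ∀ R : (sumLang t s).Relations 1,
      Structure.RelMap R (![(Sum.inr b : M ⊕ N)] : Fin 1 → (sumModel t s M N).X) ↔
        (rightTrace t s R).Realize ![b] := by
    intro R
    constructor
    · rintro (⟨y, hy, h⟩ | ⟨y, hy, h⟩)
      · exact (Sum.inr_ne_inl (congrFun hy 0)).elim
      · obtain rfl : y = ![b] := funext fun i => by
          obtain rfl := Subsingleton.elim i 0
          simpa using (Sum.inr_injective (congrFun hy 0)).symm
        exact h
    · intro h
      refine Or.inr ⟨![b], funext fun i => ?_, h⟩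
      obtain rfl := Subsingleton.elim i 0
      rfl
  constructor
  · intro h j hj
    exact h (Sum.inr j) ((key _).2 ((realize_rightTrace_inr j _).2 hj))
  · rintro h (i | j) hi
    · exact not_realize_rightTrace_inl i _ ((key _).1 hi)
    · exact h j ((realize_rightTrace_inr j _).1 ((key _).1 hi))

/-- The realizations of `p_∞` in a disjoint sum are those in the summands. -/
noncomputable def pInftySumEquiv :
    pInfty (fun i => (Sum.elim t s i).sig) (sumModel t s M N).X ≃
      pInfty (fun i => (t i).sig) M ⊕ pInfty (fun j => (s j).sig) N :=
  (Equiv.subtypeSum (α := M) (β := N)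
    (p := (· ∈ pInfty (fun i => (Sum.elim t s i).sig) (sumModel t s M N).X))).trans
    (Equiv.sumCongr (Equiv.subtypeEquivRight (inl_mem_pInfty_iff t s M N))
      (Equiv.subtypeEquivRight (inr_mem_pInfty_iff t s M N)))

end

section

variable (A : I → Type u) [iA : ∀ i, (t i).sig.lang.Structure (A i)]
  (B : J → Type u) [iB : ∀ j, (s j).sig.lang.Structure (B j)]

instance sumStructure : ∀ i, (Sum.elim t s i).sig.lang.Structure (Sum.elim A B i)
  | Sum.inl i => iA i
  | Sum.inr j => iB j

/-- The disjoint combination of two families taken together is the disjoint sum of the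
combinations of the two families. -/
def sumSigmaModel : DisjointSum (leftTrace t s) (rightTrace t s) where
  M := Σ i, A i
  M' := Σ j, B j
  X := Σ i, Sum.elim A B i
  e := (Equiv.sumSigmaDistrib (Sum.elim A B)).symm
  relMap_iff := by
    intro k R x
    cases R with
    | old R h =>
      simp only [realize_leftTrace_old, realize_rightTrace_old]
      constructor
      -- A tuple satisfying an old symbol lies within a single component, hence on one side of the
      -- sum.
      · rintro ⟨i | j, hR, y, hy, h⟩
        · refine Or.inl ⟨fun l => ⟨i, y l⟩, funext fun l => ?_, ⟨i, hR⟩, i, hR, y, fun _ => rfl, h⟩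
          exact (Equiv.symm_apply_eq _).1 (hy l)
        · refine Or.inr ⟨fun l => ⟨j, y l⟩, funext fun l => ?_, ⟨j, hR⟩, j, hR, y, fun _ => rfl, h⟩
          exact (Equiv.symm_apply_eq _).1 (hy l)
      · rintro (⟨_, rfl, -, i, hR, y, hy, h⟩ | ⟨_, rfl, -, j, hR, y, hy, h⟩)
        · refine ⟨Sum.inl i, hR, y, fun l => ?_, h⟩
          simp only [Function.comp_apply, hy]
          rfl
        · refine ⟨Sum.inr j, hR, y, fun l => ?_, h⟩
          simp only [Function.comp_apply, hy]
          rfl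
    | pred i =>
      have hx : x = fun _ => x 0 := funext fun l => by rw [Subsingleton.elim l 0]
      rcases i with i | j
      · simp only [realize_leftTrace_inl, not_realize_rightTrace_inl, and_false, exists_false,
          or_false]
        constructor
        · intro h
          rcases h0 : x 0 with a | b
          · refine ⟨fun _ => a, hx.trans (by rw [h0]; rfl), ?_⟩
            have h1 : ((Equiv.sumSigmaDistrib (Sum.elim A B)).symm (x 0)).1 = Sum.inl i := h
            rw [h0] at h1
            exact Sum.inl_injective h1
          · have h1 : ((Equiv.sumSigmaDistrib (Sum.elim A B)).symm (x 0)).1 = Sum.inl i := h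
            rw [h0] at h1
            exact (Sum.inr_ne_inl h1).elim
        · rintro ⟨y, rfl, h⟩
          exact congrArg Sum.inl h
      · simp only [realize_rightTrace_inr, not_realize_leftTrace_inr, and_false, exists_false,
          false_or]
        constructor
        · intro h
          rcases h0 : x 0 with a | b
          · have h1 : ((Equiv.sumSigmaDistrib (Sum.elim A B)).symm (x 0)).1 = Sum.inr j := h
            rw [h0] at h1
            exact (Sum.inl_ne_inr h1).elim
          · refine ⟨fun _ => b, hx.trans (by rw [h0]; rfl), ?_⟩
            have h1 : ((Equiv.sumSigmaDistrib (Sum.elim A B)).symm (x 0)).1 = Sum.inr j := h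
            rw [h0] at h1
            exact Sum.inr_injective h1
        · rintro ⟨y, rfl, h⟩
          exact congrArg Sum.inr h

end

end Sum

/-- A finite model of the theory of a restriction has the same cardinality as the restriction, so it
suffices to count the realizations of `p_∞` in the disjoint sum; its restriction then serves as its
own finite model. -/
theorem add_mem_cHatDR {Symb : ℕ → Type u} {𝒯 : Set (CompleteTheory Symb)} {m n : ℕ}
    (hm : m ∈ cHatDR 𝒯) (hn : n ∈ cHatDR 𝒯) : m + n ∈ cHatDR 𝒯 := by
  obtain ⟨I, t, ht, A, iA, hA, M, iM, hM, ⟨a⟩, C, iC, hC, hCfin, rfl⟩ := hm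
  obtain ⟨J, s, hs, B, iB, hB, N, iN, hN, -, D, iD, hD, hDfin, rfl⟩ := hn
  obtain ⟨hMfin, hMcard⟩ := finite_and_natCard_eq_of_model_completeTheory hC
  obtain ⟨hNfin, hNcard⟩ := finite_and_natCard_eq_of_model_completeTheory hD
  let e := pInftySumEquiv t s M N
  refine ⟨I ⊕ J, Sum.elim t s, ?_, Sum.elim A B, sumStructure t s A B, ?_,
    (sumModel t s M N).X, inferInstance,
    (sumModel t s M N).elementarilyEquivalent (sumSigmaModel t s A B) hM hN,
    ⟨e.symm (Sum.inl a)⟩,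
    pInfty (fun i => (Sum.elim t s i).sig) (sumModel t s M N).X, inferInstance,
    model_completeTheory, ?_, ?_⟩
  · rintro (i | j)
    exacts [ht i, hs j]
  · rintro (i | j)
    exacts [hA i, hB j]
  · exact Finite.of_equiv _ e.symm
  · rw [Nat.card_congr e, Nat.card_sum, hMcard, hNcard]

end PCombination

theorem theorem6p5 {Symb : ℕ → Type u} [IsEmpty (Symb 0)]
    (𝒯 : Set (PCombination.CompleteTheory Symb)) (h𝒯 : 𝒯.Nonempty) :
    ∃ K : Set ℕ, PCombination.cHatDR 𝒯 = PCombination.sumsOfMultiples K :=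
  ⟨PCombination.cHatDR 𝒯, (PCombination.sumsOfMultiples_eq_self
    fun _ hm _ hn => PCombination.add_mem_cHatDR hm hn).symm⟩
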